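/- Let $\Bbbk$ be a field, $n \ge 2$ and $R = \Bbbk[x]/\langle x^n\rangle$ with its standard grading. Let $\mathbb{V}$ be the $\mathbb{Q}$-vector space of matrices $v = (v_{i,j})_{i \in \mathbb{N},\, j \in \mathbb{Z}}$ with rational entries such that, for each $i$, only finitely many $v_{i,j}$ are nonzero. For a finitely generated ($\mathbb{Z}$-)graded $R$-module $M$ with minimal graded free resolution $F_0 \leftarrow F_1 \leftarrow \cdots$, $F_i = \bigoplus_{j} R(-j)^{\beta_{i,j}(M)}$, let $\beta^R(M) = (\beta_{i,j}(M))_{i,j} \in \mathbb{V}$ be its Betti diagram. An $R$-degree sequence is a sequence $d = (d_0, d_1, \ldots)$ that is either of the form $(d_0, \infty, \infty, \ldots)$ with $d_0 \in \mathbb{Z}$, or consists of integers with $d_0 < d_1 < d_2 < \cdots$ and $d_{i+2} - d_i = n$ for all $i \ge 0$ (equivalently, $d = (d_0, d_1, d_0+n, d_1+n, \ldots)$ with $d_0 < d_1 < d_0 + n$). For such $d$ let $\pi_d \in \mathbb{V}$ have entry $1$ at $(i,j)$ if $j = d_i \neq \infty$ and $0$ otherwise. For $v \in \mathbb{V}$,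 $i \in \mathbb{N}$ and $j, k \in \mathbb{Z}$ put $$\epsilon_{i,j}(v) = v_{i,j}, \qquad \alpha_{i,k}(v) = \epsilon_{i,k}(v) - \epsilon_{i+2,k+n}(v), \qquad \theta_k(v) = \sum_{j \le k} \epsilon_{2,j}(v) - \sum_{j \le k-n+1} \epsilon_{1,j}(v),$$ $$\eta_k(v) = \sum_{j \le k} \bigl(\epsilon_{1,j}(v) - \epsilon_{2,j+1}(v)\bigr), \qquad \eta_\infty(v) = \sum_{j \in \mathbb{Z}} \bigl(\epsilon_{1,j}(v) - \epsilon_{2,j+1}(v)\bigr).$$ Then the following three cones in $\mathbb{V}$ are equal: 1. the cone $\operatorname{B}_{\mathbb{Q}}(R)$ of all finite linear combinations, with nonnegative rational coefficients, of the Betti diagrams $\beta^R(M)$ of finitely generated graded $R$-modules $M$; 2. the cone $D$ of all finite linear combinations, with nonnegative rational coefficients, of the diagrams $\pi_d$ for all $R$-degree sequences $d$; 3. the cone $F$ of all $v \in \mathbb{V}$ such that $\epsilon_{i,j}(v) \ge 0$ for $i = 0, 1, 2$ and all $j \in \mathbb{Z}$; $\alpha_{0,k}(v) \ge 0$, $\theta_k(v)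 \ge 0$ and $\eta_k(v) \ge 0$ for all $k \in \mathbb{Z}$; $\alpha_{i,k}(v) = 0$ for all $i \ge 1$ and $k \in \mathbb{Z}$; and $\eta_\infty(v) = 0$. -/

import Mathlib

open Polynomial

universe u

namespace BettiCone

/-! ### Graded free modules and minimal graded free resolutions -/

section Graded

variable {k R : Type u} [Field k] [CommRing R] [Algebra k R]

/-- The degree `e` component of the graded free module `⨁ b, R(-a b)`, whose `b`-th basis element
is homogeneous of degree `a b`. Here `𝒜` is the grading of `R`. -/
def freePart (𝒜 : ℤ → Submodule k R) {m : ℕ} (a : Fin m → ℤ) (e : ℤ) : Set (Fin m → R) :=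
  {v | ∀ b, v b ∈ 𝒜 (e - a b)}

/-- The ideal of `R` generated by the homogeneous elements of positive degree. -/
def irrelevantIdeal (𝒜 : ℤ → Submodule k R) : Ideal R :=
  Ideal.span {r | ∃ i : ℤ, 0 < i ∧ r ∈ 𝒜 i}

/-- A minimal graded free resolution `M ← F₀ ← F₁ ← ⋯` of a graded `R`-module `M` with homogeneous
components `ℳ j`, where `Fᵢ = ⨁ b : Fin (rank i), R(-deg i b)`. All maps are homogeneous of
degree `0`, the augmented complex is exact, and the image of each differential lies in
`𝔪 Fᵢ`, with `𝔪` the irrelevant ideal. -/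
structure MinimalResolution (𝒜 : ℤ → Submodule k R) {M : Type u} [AddCommGroup M] [Module R M]
    (ℳ : ℤ → AddSubgroup M) where
  /-- the rank of `Fᵢ` -/
  rank : ℕ → ℕ
  /-- the degrees of the basis elements of `Fᵢ` -/
  deg : ∀ i, Fin (rank i) → ℤ
  /-- the augmentation `F₀ → M` -/
  aug : (Fin (rank 0) → R) →ₗ[R] M
  /-- the differential `Fᵢ₊₁ → Fᵢ` -/
  d : ∀ i, (Fin (rank (i + 1)) → R) →ₗ[R] (Fin (rank i) → R)
  aug_homogeneous : ∀ e, ∀ v ∈ freePart 𝒜 (deg 0) e, aug v ∈ ℳ e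
  d_homogeneous : ∀ i e, ∀ v ∈ freePart 𝒜 (deg (i + 1)) e, d i v ∈ freePart 𝒜 (deg i) e
  aug_surjective : Function.Surjective aug
  exact_zero : Function.Exact (d 0) aug
  exact_succ : ∀ i, Function.Exact (d (i + 1)) (d i)
  minimal : ∀ i v b, d i v b ∈ irrelevantIdeal 𝒜

end Graded

/-! ### The space of diagrams -/

/-- The `ℚ`-vector space of column-finite matrices with columns indexed by `i : ℕ` and rows indexed
by `j : ℤ`; the entry of `v` at `(i, j)` is `v i j`. -/
abbrev Diagram : Type := ℕ → ℤ →₀ ℚ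

/-- The Betti diagram read off from a minimal graded free resolution: its `(i, j)` entry is the
number of basis elements of `Fᵢ` of degree `j`. -/
noncomputable def MinimalResolution.betti {k R : Type u} [Field k] [CommRing R] [Algebra k R]
    {𝒜 : ℤ → Submodule k R} {M : Type u} [AddCommGroup M] [Module R M] {ℳ : ℤ → AddSubgroup M}
    (F : MinimalResolution 𝒜 ℳ) : Diagram :=
  fun i => ∑ b : Fin (F.rank i), Finsupp.single (F.deg i b) 1

/-! ### The ring `k[x]/⟨xⁿ⟩` and its cone of Betti diagrams -/

/-- The ring `k[x]/⟨xⁿ⟩`. -/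
abbrev TruncPoly (k : Type u) [Field k] (n : ℕ) : Type u :=
  k[X] ⧸ Ideal.span {(X ^ n : k[X])}

/-- The standard grading of `k[x]/⟨xⁿ⟩`: the component of degree `i` is spanned by the class of
`x ^ i` if `i ≥ 0`, and is zero if `i < 0`. -/
noncomputable def stdGrading (k : Type u) [Field k] (n : ℕ) (i : ℤ) :
    Submodule k (TruncPoly k n) :=
  Submodule.span k {r | ∃ a : ℕ, (a : ℤ) = i ∧ r = Ideal.Quotient.mk _ (X ^ a)}

/-- The set of Betti diagrams of finitely generated (`ℤ`-)graded modules over `k[x]/⟨xⁿ⟩`. -/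
def bettiDiagrams (k : Type u) [Field k] (n : ℕ) : Set Diagram :=
  {v | ∃ (M : Type u) (_ : AddCommGroup M) (_ : Module (TruncPoly k n) M)
      (ℳ : ℤ → AddSubgroup M),
      Module.Finite (TruncPoly k n) M ∧
      DirectSum.IsInternal ℳ ∧
      SetLike.GradedSMul (stdGrading k n) ℳ ∧
      ∃ F : MinimalResolution (stdGrading k n) ℳ, v = F.betti}

/-- The cone of Betti diagrams: all finite combinations of Betti diagrams of finitely generated
graded modules with nonnegative rational coefficients. -/
noncomputable def bettiCone (k : Type u) [Field k] (n : ℕ) : PointedCone ℚ Diagram :=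
  PointedCone.hull ℚ (bettiDiagrams k n)

/-! ### Degree sequences and pure diagrams -/

/-- Degree sequences over `k[x]/⟨xⁿ⟩`: either `(d₀, ∞, ∞, …)` with `d₀` an integer, or a strictly
increasing sequence of integers with `dᵢ₊₂ - dᵢ = n` for all `i`. -/
def IsDegreeSequence (n : ℕ) (d : ℕ → WithTop ℤ) : Prop :=
  (d 0 ≠ ⊤ ∧ ∀ i, 1 ≤ i → d i = ⊤) ∨
  (∃ e : ℕ → ℤ, (∀ i, d i = (e i : WithTop ℤ)) ∧ StrictMono e ∧ ∀ i, e (i + 2) - e i = n)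

/-- The pure diagram `π_d`, with entry `1` at `(i, j)` if `j = dᵢ ≠ ∞`, and `0` elsewhere. -/
noncomputable def pureDiagram (d : ℕ → WithTop ℤ) : Diagram := fun i =>
  match d i with
  | ⊤ => 0
  | (j : ℤ) => Finsupp.single j 1

/-- The cone spanned by the pure diagrams of all degree sequences. -/
noncomputable def pureCone (n : ℕ) : PointedCone ℚ Diagram :=
  PointedCone.hull ℚ {v | ∃ d, IsDegreeSequence n d ∧ v = pureDiagram d}

/-! ### Functionals and the cone they cut out

All sums below have only finitely many nonzero terms, since diagrams are column-finite. -/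

/-- `ε_{i,j}(v) = v_{i,j}`. -/
def ε (i : ℕ) (j : ℤ) (v : Diagram) : ℚ := v i j

/-- `α_{i,j} = ε_{i,j} - ε_{i+2,j+n}`. -/
def α (n : ℕ) (i : ℕ) (j : ℤ) (v : Diagram) : ℚ := ε i j v - ε (i + 2) (j + n) v

/-- `θ_l = ∑_{j ≤ l} ε_{2,j} - ∑_{j ≤ l-n+1} ε_{1,j}`. -/
noncomputable def θ (n : ℕ) (l : ℤ) (v : Diagram) : ℚ :=
  (∑ᶠ j ∈ Set.Iic l, ε 2 j v) - ∑ᶠ j ∈ Set.Iic (l - n + 1), ε 1 j v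

/-- `η_l = ∑_{j ≤ l} (ε_{1,j} - ε_{2,j+1})`. -/
noncomputable def η (l : ℤ) (v : Diagram) : ℚ :=
  ∑ᶠ j ∈ Set.Iic l, (ε 1 j v - ε 2 (j + 1) v)

/-- `η_∞ = ∑_j (ε_{1,j} - ε_{2,j+1})`, the sum over all integers `j`. -/
noncomputable def ηInfty (v : Diagram) : ℚ :=
  ∑ᶠ j : ℤ, (ε 1 j v - ε 2 (j + 1) v)

/-- The cone `F`, the intersection of the halfspaces given by the functionals above. -/
def facetCone (n : ℕ) : Set Diagram :=
  {v | (∀ i, i ≤ 2 → ∀ j, 0 ≤ ε i j v) ∧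
       (∀ l, 0 ≤ α n 0 l v) ∧
       (∀ l, 0 ≤ θ n l v) ∧
       (∀ l, 0 ≤ η l v) ∧
       (∀ i, 1 ≤ i → ∀ l, α n i l v = 0) ∧
       ηInfty v = 0}

end BettiCone

namespace BettiCone

/-! ### Cumulative sums -/

/-! The proof shows D = F, B ⊆ F and D ⊆ B.

D ⊆ F is checked on each π_d. For F ⊆ D, the equations α_{i,k} = 0 make columns i ≥ 1 periodic, so
`v` is determined by columns 0, 1, 2. Let a be column 2 moved down by n and b column 1. Then α_{0,k}
≥ 0 says that v_0 - a is nonnegative; it is a combination of diagrams of free modules. The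
conditions θ ≥ 0, η ≥ 0 and η_∞ = 0 say that the mass a can be transported to b with every
displacement in [1, n-1]. Matching leftmost mass with leftmost mass realizes the transport, and each
matched pair is a degree sequence (`periodicDiagram_mem_pureCone`).

For B ⊆ F let Z_i be the image of F_{i+1} → F_i. Minimality gives two counts: generators, dim
(Z_i)_{e+1} - dim x(Z_i)_e = β_{i+1,e+1} (`finrank_map_mulRoot_syzygy`), and, for i ≥ 1, the kernel
of x on (Z_i)_e, of dimension β_{i,e+1-n}, since Z_i contains the socle of F_i
(`finrank_map_mulRoot_syzygy_succ`). They yield the periodicity, the bound on column 2 by column 0,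
and ∑_{j ≤ l} (β_{1,j} - β_{2,j}) = dim (Z_0)_l (`cumSum_betti_two`). Hence η_l = dim x(Z_0)_l, θ_l
= dim x(Z_1)_l and η_∞ = 0.

For D ⊆ B, π_d is the Betti diagram of R(-d_0) or of R/⟨x^{d_1-d_0}⟩(-d_0). -/

/-- The cumulative sum `∑_{j ≤ l} f j`, as a linear functional. -/
noncomputable def cumSum (l : ℤ) : (ℤ →₀ ℚ) →ₗ[ℚ] ℚ :=
  Finsupp.linearCombination ℚ fun j => if j ≤ l then 1 else 0

/-- The total sum `∑_j f j`, as a linear functional. -/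
noncomputable def totalSum : (ℤ →₀ ℚ) →ₗ[ℚ] ℚ :=
  Finsupp.linearCombination ℚ fun _ => 1

lemma cumSum_single (l j : ℤ) (c : ℚ) :
    cumSum l (Finsupp.single j c) = if j ≤ l then c else 0 := by
  simp [cumSum]

lemma totalSum_single (j : ℤ) (c : ℚ) : totalSum (Finsupp.single j c) = c := by
  simp [totalSum]

lemma finsum_mem_Iic_eq_cumSum (l : ℤ) (f : ℤ →₀ ℚ) :
    ∑ᶠ j ∈ Set.Iic l, f j = cumSum l f := by
  rw [finsum_mem_def, finsum_eq_sum_of_support_subset (s := f.support)]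
  · rw [cumSum, Finsupp.linearCombination_apply, Finsupp.sum]
    refine Finset.sum_congr rfl fun j _ => ?_
    by_cases h : j ≤ l <;> simp [h]
  · intro j hj
    simp only [Function.mem_support, ne_eq, Set.indicator_apply_eq_zero, not_forall] at hj
    simpa using hj.2

lemma finsum_eq_totalSum (f : ℤ →₀ ℚ) : ∑ᶠ j, f j = totalSum f := by
  rw [finsum_eq_sum_of_support_subset (s := f.support)]
  · rw [totalSum, Finsupp.linearCombination_apply, Finsupp.sum]
    simp
  · intro j hj
    simpa using hj

/-- The shift `(shift m f) (j + m) = f j`. -/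
noncomputable def shift (m : ℤ) : (ℤ →₀ ℚ) →ₗ[ℚ] (ℤ →₀ ℚ) := Finsupp.lmapDomain ℚ ℚ (· + m)

lemma shift_apply (m : ℤ) (f : ℤ →₀ ℚ) (j : ℤ) : shift m f j = f (j - m) := by
  have h := Finsupp.mapDomain_apply (add_left_injective m) f (j - m)
  simpa [shift] using h

lemma shift_single (m j : ℤ) (c : ℚ) :
    shift m (Finsupp.single j c) = Finsupp.single (j + m) c := by
  simp [shift]

lemma theta_eq (n : ℕ) (l : ℤ) (v : Diagram) :
    θ n l v = cumSum l (v 2) - cumSum (l - n + 1) (v 1) := by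
  simp only [θ, ε, finsum_mem_Iic_eq_cumSum]

lemma cumSum_shift (m l : ℤ) (f : ℤ →₀ ℚ) : cumSum l (shift m f) = cumSum (l - m) f := by
  induction f using Finsupp.induction_linear with
  | zero => simp
  | add f g hf hg => rw [map_add, map_add, map_add, hf, hg]
  | single j c =>
    rw [shift_single, cumSum_single, cumSum_single]
    simp only [le_sub_iff_add_le]

lemma totalSum_shift (m : ℤ) (f : ℤ →₀ ℚ) : totalSum (shift m f) = totalSum f := by
  induction f using Finsupp.induction_linear with
  | zero => simp
  | add f g hf hg => rw [map_add, map_add, map_add, hf, hg]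
  | single j c => rw [shift_single, totalSum_single, totalSum_single]

lemma eta_eq (l : ℤ) (v : Diagram) : η l v = cumSum l (v 1) - cumSum (l + 1) (v 2) := by
  have h : ∀ j, v 1 j - v 2 (j + 1) = (v 1 - shift (-1) (v 2)) j := fun j => by
    rw [Finsupp.sub_apply, shift_apply, sub_neg_eq_add]
  simp only [η, ε, h]
  rw [finsum_mem_Iic_eq_cumSum, map_sub, cumSum_shift, sub_neg_eq_add]

lemma etaInfty_eq (v : Diagram) : ηInfty v = totalSum (v 1) - totalSum (v 2) := by
  have h : ∀ j, v 1 j - v 2 (j + 1) = (v 1 - shift (-1) (v 2)) j := fun j => by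
    rw [Finsupp.sub_apply, shift_apply, sub_neg_eq_add]
  simp only [ηInfty, ε, h]
  rw [finsum_eq_totalSum, map_sub, totalSum_shift]

/-- Every condition becomes a comparison of linear functionals, so stability under sums and
nonnegative multiples is immediate. -/
lemma mem_facetCone_iff (n : ℕ) (v : Diagram) :
    v ∈ facetCone n ↔ (∀ i, i ≤ 2 → ∀ j, 0 ≤ v i j) ∧ (∀ l, v 2 (l + n) ≤ v 0 l) ∧
      (∀ l : ℤ, cumSum (l - n + 1) (v 1) ≤ cumSum l (v 2)) ∧
      (∀ l, cumSum (l + 1) (v 2) ≤ cumSum l (v 1)) ∧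
      (∀ i, 1 ≤ i → ∀ l, v i l = v (i + 2) (l + n)) ∧ totalSum (v 1) = totalSum (v 2) := by
  simp only [facetCone, Set.mem_ofPred_eq, theta_eq, eta_eq, etaInfty_eq, α, ε, sub_nonneg,
    sub_eq_zero, zero_add]

lemma cumSum_sub_cumSum_sub_one (l : ℤ) (f : ℤ →₀ ℚ) : cumSum l f - cumSum (l - 1) f = f l := by
  induction f using Finsupp.induction_linear with
  | zero => simp
  | add f g hf hg => rw [map_add, map_add, Finsupp.add_apply, ← hf, ← hg]; ring
  | single j c =>
    rw [cumSum_single, cumSum_single, Finsupp.single_apply]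
    split_ifs <;> first | omega | simp

lemma cumSum_nonneg {f : ℤ →₀ ℚ} (hf : ∀ j, 0 ≤ f j) (l : ℤ) : 0 ≤ cumSum l f := by
  rw [cumSum, Finsupp.linearCombination_apply]
  refine Finset.sum_nonneg fun j _ => smul_nonneg (hf j) ?_
  split_ifs <;> simp

lemma le_cumSum {f : ℤ →₀ ℚ} (hf : ∀ j, 0 ≤ f j) {j l : ℤ} (hj : j ≤ l) : f j ≤ cumSum l f := by
  have h : f = Finsupp.single j (f j) + f.erase j := (Finsupp.single_add_erase j f).symm
  have h' : 0 ≤ cumSum l (f.erase j) := cumSum_nonneg (fun i => by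
    rw [Finsupp.erase_apply]; split_ifs <;> simp [hf]) l
  have h2 := congrArg (cumSum l) h
  rw [map_add, cumSum_single, if_pos hj] at h2
  linarith

lemma cumSum_eq_zero {f : ℤ →₀ ℚ} {l : ℤ} (h : ∀ j ≤ l, f j = 0) : cumSum l f = 0 := by
  rw [cumSum, Finsupp.linearCombination_apply]
  refine Finset.sum_eq_zero fun j _ => ?_
  by_cases hj : j ≤ l <;> simp [hj, h]

lemma cumSum_eq_totalSum {f : ℤ →₀ ℚ} {l : ℤ} (h : ∀ j, l < j → f j = 0) :
    cumSum l f = totalSum f := by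
  rw [cumSum, totalSum, Finsupp.linearCombination_apply, Finsupp.linearCombination_apply]
  refine Finset.sum_congr rfl fun j _ => ?_
  by_cases hj : j ≤ l
  · simp [hj]
  · simp [h j (not_le.mp hj)]

lemma eq_zero_of_totalSum_eq_zero {f : ℤ →₀ ℚ} (hf : ∀ j, 0 ≤ f j) (h : totalSum f = 0) :
    f = 0 := by
  ext j
  rw [totalSum, Finsupp.linearCombination_apply, Finsupp.sum,
    Finset.sum_eq_zero_iff_of_nonneg (fun j _ => by simpa using hf j)] at h
  by_contra hj
  exact hj (by simpa using h j (by simpa using hj))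

/-! ### The cone of pure diagrams lies in the cone cut out by the functionals -/

lemma pureDiagram_mem_facetCone {n : ℕ} {d : ℕ → WithTop ℤ} (hd : IsDegreeSequence n d) :
    pureDiagram d ∈ facetCone n := by
  rw [mem_facetCone_iff]
  have hnn : ∀ i j, 0 ≤ pureDiagram d i j := by
    intro i j
    unfold pureDiagram
    split
    · simp
    · rw [Finsupp.single_apply]; split_ifs <;> simp
  rcases hd with ⟨-, h⟩ | ⟨e, he, hmono, hstep⟩
  · have h0 : ∀ i, 1 ≤ i → pureDiagram d i = 0 := fun i hi => by simp [pureDiagram, h i hi]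
    have h1 := h0 1 le_rfl
    have h2 := h0 2 one_le_two
    refine ⟨fun i _ => hnn i, fun l => by simpa [h2] using hnn 0 l, ?_, ?_, ?_, ?_⟩
    · simp [h1, h2]
    · simp [h1, h2]
    · intro i hi l
      simp [h0 i hi, h0 (i + 2) (by omega)]
    · simp [h1, h2]
  · have hp : ∀ i, pureDiagram d i = Finsupp.single (e i) 1 := fun i => by
      simp [pureDiagram, he i]
    -- All inequalities reduce to e 0 < e 1 < e 2 = e 0 + n: for θ, e 1 ≤ l - n + 1 forces e 2 ≤ l;
    -- for η, e 2 ≤ l + 1 forces e 1 ≤ l.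
    have h01 := hmono (show 0 < 1 by omega)
    have h12 := hmono (show 1 < 2 by omega)
    have h02 := hstep 0
    refine ⟨fun i _ => hnn i, ?_, ?_, ?_, ?_, ?_⟩
    · intro l
      rw [hp, hp, Finsupp.single_apply, Finsupp.single_apply]
      simp only [zero_add] at h02
      split_ifs <;> first | omega | simp
    · intro l
      rw [hp, hp, cumSum_single, cumSum_single]
      simp only [zero_add] at h02
      split_ifs <;> first | omega | simp
    · intro l
      rw [hp, hp, cumSum_single, cumSum_single]
      split_ifs <;> first | omega | simp
    · intro i _ l
      rw [hp, hp, Finsupp.single_apply, Finsupp.single_apply]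
      have := hstep i
      split_ifs <;> first | omega | simp
    · rw [hp, hp, totalSum_single, totalSum_single]

lemma pureCone_subset_facetCone (n : ℕ) : (pureCone n : Set Diagram) ⊆ facetCone n := by
  intro v hv
  induction hv using Submodule.span_induction with
  | mem v hv =>
    obtain ⟨d, hd, rfl⟩ := hv
    exact pureDiagram_mem_facetCone hd
  | zero => simp [mem_facetCone_iff]
  | add v w _ _ hv hw =>
    rw [mem_facetCone_iff] at *
    obtain ⟨h1, h2, h3, h4, h5, h6⟩ := hv
    obtain ⟨g1, g2, g3, g4, g5, g6⟩ := hw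
    simp only [Pi.add_apply, map_add, Finsupp.add_apply]
    exact ⟨fun i hi j => add_nonneg (h1 i hi j) (g1 i hi j), fun l => add_le_add (h2 l) (g2 l),
      fun l => add_le_add (h3 l) (g3 l), fun l => add_le_add (h4 l) (g4 l),
      fun i hi l => by rw [h5 i hi l, g5 i hi l], by rw [h6, g6]⟩
  | smul c v _ hv =>
    rw [mem_facetCone_iff] at *
    obtain ⟨h1, h2, h3, h4, h5, h6⟩ := hv
    obtain ⟨c, hc⟩ := c
    have e : ∀ i, ((⟨c, hc⟩ : {c : ℚ // 0 ≤ c}) • v) i = c • v i := fun i => rfl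
    simp only [e, map_smul, Finsupp.smul_apply, smul_eq_mul]
    exact ⟨fun i hi j => mul_nonneg hc (h1 i hi j), fun l => mul_le_mul_of_nonneg_left (h2 l) hc,
      fun l => mul_le_mul_of_nonneg_left (h3 l) hc, fun l => mul_le_mul_of_nonneg_left (h4 l) hc,
      fun i hi l => by rw [h5 i hi l], by rw [h6]⟩

/-! ### The cone cut out by the functionals is spanned by pure diagrams -/

/-- The diagram whose even columns are shifts of `a` and whose odd columns are shifts of `b`. -/
noncomputable def periodicDiagram (n : ℕ) : (ℤ →₀ ℚ) × (ℤ →₀ ℚ) →ₗ[ℚ] Diagram :=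
  LinearMap.pi fun i => shift ((i / 2 : ℕ) * n) ∘ₗ
    if i % 2 = 0 then LinearMap.fst ℚ _ _ else LinearMap.snd ℚ _ _

lemma smul_mem_pureCone {n : ℕ} {v : Diagram} (hv : v ∈ pureCone n) {c : ℚ} (hc : 0 ≤ c) :
    c • v ∈ pureCone n :=
  (pureCone n).smul_mem hc hv

lemma pureDiagram_mem_pureCone {n : ℕ} {d : ℕ → WithTop ℤ} (hd : IsDegreeSequence n d) :
    pureDiagram d ∈ pureCone n :=
  Submodule.subset_span ⟨d, hd, rfl⟩

lemma single_mem_pureCone (n : ℕ) (j : ℤ) :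
    (Pi.single 0 (Finsupp.single j 1) : Diagram) ∈ pureCone n := by
  have hd : IsDegreeSequence n fun i => if i = 0 then (j : WithTop ℤ) else ⊤ :=
    Or.inl ⟨by simp, fun i hi => by simp; omega⟩
  convert pureDiagram_mem_pureCone hd using 1
  funext i
  rcases i with _ | i
  · simp [pureDiagram]
  · simp [pureDiagram]

lemma periodicDiagram_single_mem_pureCone {n : ℕ} {p q : ℤ} (h1 : p < q) (h2 : q < p + n) :
    periodicDiagram n (Finsupp.single p 1, Finsupp.single q 1) ∈ pureCone n := by
  have hd : IsDegreeSequence n fun i =>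
      (((if i % 2 = 0 then p else q) + (i / 2 : ℕ) * n : ℤ) : WithTop ℤ) := by
    refine Or.inr ⟨_, fun i => rfl, strictMono_nat_of_lt_succ fun i => ?_, fun i => ?_⟩
    · rcases Nat.even_or_odd' i with ⟨m, rfl | rfl⟩
      · have e1 : (2 * m + 1) / 2 = m := by omega
        have e2 : (2 * m) / 2 = m := by omega
        simp [e1, e2, Nat.add_mod, h1]
      · have e1 : (2 * m + 1 + 1) / 2 = m + 1 := by omega
        have e2 : (2 * m + 1) / 2 = m := by omega
        have e3 : (2 * m + 1 + 1) % 2 = 0 := by omega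
        have e4 : (2 * m + 1) % 2 = 1 := by omega
        simp only [e1, e2, e3, e4]
        push_cast
        simp
        linarith
    · have e1 : (i + 2) / 2 = i / 2 + 1 := by omega
      have e2 : (i + 2) % 2 = i % 2 := by omega
      rw [e1, e2]
      push_cast
      ring
  convert pureDiagram_mem_pureCone hd using 1
  funext i
  simp only [periodicDiagram, pureDiagram, LinearMap.pi_apply, LinearMap.comp_apply]
  split_ifs <;> simp [shift_single]

lemma sub_single_nonneg {f : ℤ →₀ ℚ} {p : ℤ} {t : ℚ} (hf : ∀ j, 0 ≤ f j) (ht : t ≤ f p) (j : ℤ) :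
    0 ≤ (f - Finsupp.single p t) j := by
  rw [Finsupp.sub_apply, Finsupp.single_apply]
  split_ifs with h
  · subst h; linarith
  · simpa using hf j

lemma support_sub_single_subset {f : ℤ →₀ ℚ} {p : ℤ} (hp : p ∈ f.support) (t : ℚ) :
    (f - Finsupp.single p t).support ⊆ f.support := by
  intro j hj
  by_cases h : p = j
  · exact h ▸ hp
  · simpa [Finsupp.single_apply, h] using hj

lemma card_support_sub_single_self {f : ℤ →₀ ℚ} {p : ℤ} (hp : p ∈ f.support) :
    (f - Finsupp.single p (f p)).support.card < f.support.card :=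
  Finset.card_lt_card ⟨support_sub_single_subset hp _, fun h => by simpa using h hp⟩

lemma cumSum_eq_zero_of_lt_min {f : ℤ →₀ ℚ} {p l : ℤ} (hp : ∀ j ∈ f.support, p ≤ j) (hl : l < p) :
    cumSum l f = 0 :=
  cumSum_eq_zero fun j hj => by
    by_contra h
    have := hp j (by simpa using h)
    omega

/-- If the mass distributions `a` and `b` have the same total, and `b` is obtained by moving the
mass of `a` to the right by at least `1` and at most `n - 1`, then the diagram is a combination of
pure diagrams. -/
lemma periodicDiagram_mem_pureCone {n : ℕ} {a b : ℤ →₀ ℚ} (ha : ∀ j, 0 ≤ a j) (hb : ∀ j, 0 ≤ b j)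
    (hab : ∀ l, cumSum (l + 1) b ≤ cumSum l a) (hba : ∀ l : ℤ, cumSum (l + 1 - n) a ≤ cumSum l b)
    (htot : totalSum a = totalSum b) : periodicDiagram n (a, b) ∈ pureCone n := by
  induction hN : a.support.card + b.support.card using Nat.strong_induction_on generalizing a b with
  | _ N ih =>
  by_cases ha0 : a = 0
  · have hb0 : b = 0 := eq_zero_of_totalSum_eq_zero hb (by rw [← htot, ha0, map_zero])
    rw [ha0, hb0, Prod.mk_zero_zero, map_zero]
    exact zero_mem _
  have hb0 : b ≠ 0 := fun h => ha0 (eq_zero_of_totalSum_eq_zero ha (by rw [htot, h, map_zero]))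
  obtain ⟨p, hpa, hpmin⟩ := Finset.exists_min_image a.support id (Finsupp.support_nonempty_iff.2 ha0)
  obtain ⟨q, hqb, hqmin⟩ := Finset.exists_min_image b.support id (Finsupp.support_nonempty_iff.2 hb0)
  simp only [id] at hpmin hqmin
  have hap : 0 < a p := lt_of_le_of_ne (ha p) (by simpa [eq_comm] using hpa)
  have hbq : 0 < b q := lt_of_le_of_ne (hb q) (by simpa [eq_comm] using hqb)
  -- If q ≤ p, then `hab` at q - 1 bounds the positive mass b q by the mass of a strictly left of p,
  -- which is zero. The bound `hqp` follows in the same way from `hba`.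
  have hpq : p < q := by
    by_contra h
    have h1 := hab (q - 1)
    rw [cumSum_eq_zero_of_lt_min hpmin (show q - 1 < p by omega), sub_add_cancel] at h1
    have := le_cumSum hb (le_refl q)
    linarith
  have hqp : q < p + n := by
    by_contra h
    have h1 := hba (p + n - 1)
    rw [cumSum_eq_zero_of_lt_min hqmin (show p + n - 1 < q by omega),
      show p + n - 1 + 1 - n = p by ring] at h1
    have := le_cumSum ha (le_refl p)
    linarith
  -- With this choice p leaves the support of a or q leaves that of b, so the induction measure
  -- drops.
  set t := min (a p) (b q) with ht
  have hta : t ≤ a p := min_le_left _ _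
  have htb : t ≤ b q := min_le_right _ _
  have ht0 : 0 ≤ t := le_min hap.le hbq.le
  have hdec : periodicDiagram n (a, b) =
      periodicDiagram n (a - Finsupp.single p t, b - Finsupp.single q t) +
        t • periodicDiagram n (Finsupp.single p 1, Finsupp.single q 1) := by
    rw [← map_smul, ← map_add]
    simp
  rw [hdec]
  refine add_mem (ih _ ?_ (sub_single_nonneg ha hta) (sub_single_nonneg hb htb) ?_ ?_ ?_ rfl)
    (smul_mem_pureCone (periodicDiagram_single_mem_pureCone hpq hqp) ht0)
  · rw [← hN]
    rcases min_choice (a p) (b q) with h | h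
    · rw [ht, h]
      exact add_lt_add_of_lt_of_le (card_support_sub_single_self hpa)
        (Finset.card_le_card (support_sub_single_subset hqb _))
    · rw [ht, h]
      exact add_lt_add_of_le_of_lt (Finset.card_le_card (support_sub_single_subset hpa _))
        (card_support_sub_single_self hqb)
  -- Only p ≤ l < q - 1 needs care: there the left side vanishes, as q is the leftmost point of b,
  -- and the right side keeps at least a p - t ≥ 0.
  · intro l
    rw [map_sub, map_sub, cumSum_single, cumSum_single]
    have h := hab l
    split_ifs with h1 h2 h2
    · linarith
    · omega
    · rw [cumSum_eq_zero_of_lt_min hqmin (not_le.1 h1)]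
      have := le_cumSum ha h2
      linarith
    · linarith
  · intro l
    rw [map_sub, map_sub, cumSum_single, cumSum_single]
    have h := hba l
    split_ifs with h1 h2 h2
    · linarith
    · omega
    · rw [cumSum_eq_zero_of_lt_min hpmin (not_le.1 h1)]
      have := le_cumSum hb h2
      linarith
    · linarith
  · rw [map_sub, map_sub, totalSum_single, totalSum_single, htot]

lemma pi_single_zero_mem_pureCone (n : ℕ) {f : ℤ →₀ ℚ} (hf : ∀ j, 0 ≤ f j) :
    (Pi.single 0 f : Diagram) ∈ pureCone n := by
  have h : (Pi.single 0 f : Diagram) =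
      ∑ j ∈ f.support, f j • (Pi.single 0 (Finsupp.single j 1) : Diagram) := by
    have h1 : f = ∑ j ∈ f.support, f j • Finsupp.single j 1 := by
      conv_lhs => rw [← Finsupp.sum_single f]
      simp [Finsupp.sum]
    conv_lhs => rw [h1]
    have h2 := map_sum (LinearMap.single ℚ (fun _ : ℕ => ℤ →₀ ℚ) 0)
      (fun j => f j • Finsupp.single j (1 : ℚ)) f.support
    simpa only [map_smul, LinearMap.coe_single] using h2
  rw [h]
  exact sum_mem fun j _ => smul_mem_pureCone (single_mem_pureCone n j) (hf j)

lemma facetCone_subset_pureCone (n : ℕ) : facetCone n ⊆ (pureCone n : Set Diagram) := by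
  intro v hv
  rw [mem_facetCone_iff] at hv
  obtain ⟨h1, h2, h3, h4, h5, h6⟩ := hv
  have hper : ∀ i, 1 ≤ i → v (i + 2) = shift n (v i) := by
    intro i hi
    ext l
    rw [shift_apply, h5 i hi (l - n), sub_add_cancel]
  set a := shift (-n) (v 2) with ha
  have hshift : shift n a = v 2 := by
    ext l
    simp [ha, shift_apply]
  -- Columns 1 and 2 agree by the choice of a, later ones by periodicity; the last summand corrects
  -- column 0, where no equality with a is imposed.
  have hv : v = periodicDiagram n (a, v 1) + Pi.single 0 (v 0 - a) := by
    funext i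
    induction i using Nat.strong_induction_on with
    | _ i ih =>
    match i with
    | 0 =>
      ext l
      simp [periodicDiagram, shift_apply]
    | 1 =>
      ext l
      simp [periodicDiagram, shift_apply]
    | 2 =>
      ext l
      rw [← hshift]
      simp [periodicDiagram, shift_apply]
    | i + 3 =>
      have := ih (i + 1) (by omega)
      rw [show i + 3 = i + 1 + 2 by ring, hper (i + 1) (by omega), this]
      ext l
      have e1 : (i + 1 + 2) / 2 = (i + 1) / 2 + 1 := by omega
      have e2 : (i + 1 + 2) % 2 = (i + 1) % 2 := by omega
      simp only [periodicDiagram, e1, e2, Pi.add_apply, LinearMap.pi_apply, LinearMap.comp_apply]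
      rw [Pi.single_eq_of_ne (by omega), Pi.single_eq_of_ne (by omega)]
      simp only [add_zero, shift_apply]
      congr 1
      push_cast
      ring
  rw [hv]
  refine add_mem (periodicDiagram_mem_pureCone ?_ (h1 1 (by norm_num)) ?_ ?_ ?_)
    (pi_single_zero_mem_pureCone n ?_)
  · intro j
    rw [ha, shift_apply]
    exact h1 2 le_rfl _
  · intro l
    rw [ha, cumSum_shift]
    -- Since a is column 2 shifted by -n, θ at l + n is the condition that mass moves right by at
    -- least 1, and η at l that it moves by at most n - 1.
    convert h3 (l + n) using 2
    · ring_nf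
    · ring_nf
  · intro l
    rw [ha, cumSum_shift]
    convert h4 l using 2
    ring_nf
  · rw [ha, totalSum_shift, h6]
  · intro j
    have := h2 j
    rw [Finsupp.sub_apply, ha, shift_apply, sub_neg_eq_add]
    linarith

theorem pureCone_eq_facetCone (n : ℕ) : (pureCone n : Set Diagram) = facetCone n :=
  (pureCone_subset_facetCone n).antisymm (facetCone_subset_pureCone n)

/-! ### The graded ring `k[x]/⟨xⁿ⟩` -/

section Ring

variable (k : Type u) [Field k] (n : ℕ)

/-- The class of `x` in `k[x]/⟨xⁿ⟩`. -/
noncomputable abbrev root : TruncPoly k n := Ideal.Quotient.mk _ X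

/-- The basis `1, x, …, xⁿ⁻¹` of `k[x]/⟨xⁿ⟩`. -/
noncomputable def powBasis : Module.Basis (Fin n) k (TruncPoly k n) :=
  -- `AdjoinRoot (X ^ n)` is by definition the same quotient ring.
  ((AdjoinRoot.powerBasis' (monic_X_pow (R := k) n)).basis.reindex
    (finCongr (by simp)) : Module.Basis (Fin n) k (AdjoinRoot (X ^ n : k[X])))

variable {k n}

lemma powBasis_apply (j : Fin n) : powBasis k n j = root k n ^ (j : ℕ) := by
  have h : (AdjoinRoot.powerBasis' (monic_X_pow (R := k) n)).basis.reindex (finCongr (by simp)) j =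
      AdjoinRoot.root (X ^ n : k[X]) ^ (j : ℕ) := by
    rw [Module.Basis.reindex_apply, PowerBasis.basis_eq_pow, AdjoinRoot.powerBasis'_gen]
    rfl
  exact h

lemma root_pow_mul_eq_zero {c : ℕ} (hc : c ≤ n) {r : TruncPoly k n} (h : root k n ^ c * r = 0) :
    ∃ s, r = root k n ^ (n - c) * s := by
  obtain ⟨p, rfl⟩ := Ideal.Quotient.mk_surjective r
  rw [← map_pow, ← map_mul, Ideal.Quotient.eq_zero_iff_mem, Ideal.mem_span_singleton] at h
  have h1 : (X ^ c * X ^ (n - c) : k[X]) ∣ X ^ c * p := by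
    rwa [← pow_add, Nat.add_sub_cancel' hc]
  obtain ⟨q, rfl⟩ := (mul_dvd_mul_iff_left (pow_ne_zero c X_ne_zero)).1 h1
  exact ⟨Ideal.Quotient.mk _ q, by simp⟩

lemma root_pow_eq_zero_iff {a : ℕ} : root k n ^ a = 0 ↔ n ≤ a := by
  rw [← map_pow, Ideal.Quotient.eq_zero_iff_mem, Ideal.mem_span_singleton]
  exact pow_dvd_pow_iff X_ne_zero not_isUnit_X

lemma stdGrading_natCast (a : ℕ) :
    stdGrading k n a = Submodule.span k {root k n ^ a} := by
  unfold stdGrading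
  congr 1
  ext r
  simp [root]

lemma stdGrading_of_neg {i : ℤ} (hi : i < 0) : stdGrading k n i = ⊥ := by
  unfold stdGrading
  rw [Submodule.span_eq_bot]
  rintro r ⟨a, ha, -⟩
  omega

/-- A case distinction for the elements of a homogeneous component. -/
lemma exists_of_mem_stdGrading {i : ℤ} {r : TruncPoly k n} (hr : r ∈ stdGrading k n i) :
    r = 0 ∨ ∃ (a : ℕ) (c : k), (a : ℤ) = i ∧ r = c • root k n ^ a := by
  rcases lt_or_ge i 0 with hi | hi
  · left
    simpa [stdGrading_of_neg hi] using hr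
  · right
    lift i to ℕ using hi
    rw [stdGrading_natCast, Submodule.mem_span_singleton] at hr
    obtain ⟨c, rfl⟩ := hr
    exact ⟨i, c, rfl, rfl⟩

lemma root_pow_mem (a : ℕ) : root k n ^ a ∈ stdGrading k n a := by
  rw [stdGrading_natCast]
  exact Submodule.mem_span_singleton_self _

lemma mul_mem_stdGrading {i j : ℤ} {r s : TruncPoly k n} (hr : r ∈ stdGrading k n i)
    (hs : s ∈ stdGrading k n j) : r * s ∈ stdGrading k n (i + j) := by
  rcases exists_of_mem_stdGrading hr with rfl | ⟨a, c, rfl, rfl⟩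
  · simp
  rcases exists_of_mem_stdGrading hs with rfl | ⟨b, c', rfl, rfl⟩
  · simp
  rw [smul_mul_smul_comm, ← pow_add, ← Nat.cast_add]
  exact Submodule.smul_mem _ _ (root_pow_mem _)

lemma finrank_stdGrading (i : ℤ) :
    Module.finrank k (stdGrading k n i) = if 0 ≤ i ∧ i < n then 1 else 0 := by
  rcases lt_or_ge i 0 with hi | hi
  · rw [stdGrading_of_neg hi, finrank_bot, if_neg (by omega)]
  · lift i to ℕ using hi
    rw [stdGrading_natCast]
    split_ifs with h
    · exact finrank_span_singleton (fun h0 => by rw [root_pow_eq_zero_iff] at h0; omega)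
    · rw [root_pow_eq_zero_iff.2 (by omega)]
      simp

variable (k n) in
/-- The projection of `k[x]/⟨xⁿ⟩` onto its homogeneous component of degree `i`. -/
noncomputable def component (i : ℤ) : TruncPoly k n →ₗ[k] TruncPoly k n :=
  (powBasis k n).constr k fun j => if (j : ℤ) = i then root k n ^ (j : ℕ) else 0

lemma component_root_pow (i : ℤ) (a : ℕ) :
    component k n i (root k n ^ a) = if (a : ℤ) = i then root k n ^ a else 0 := by
  rcases lt_or_ge a n with ha | ha
  · have h := (powBasis k n).constr_basis k
      (fun j => if (j : ℤ) = i then root k n ^ (j : ℕ) else 0) ⟨a, ha⟩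
    rwa [powBasis_apply] at h
  · simp [root_pow_eq_zero_iff.2 ha]

lemma component_mem (i : ℤ) (r : TruncPoly k n) : component k n i r ∈ stdGrading k n i := by
  rw [← (powBasis k n).sum_repr r, map_sum]
  refine Submodule.sum_mem _ fun j _ => ?_
  rw [map_smul, powBasis_apply, component_root_pow]
  refine Submodule.smul_mem _ _ ?_
  split_ifs with h
  · exact h ▸ root_pow_mem _
  · exact zero_mem _

lemma component_of_mem {i j : ℤ} {r : TruncPoly k n} (hr : r ∈ stdGrading k n j) :
    component k n i r = if j = i then r else 0 := by
  rcases exists_of_mem_stdGrading hr with rfl | ⟨a, c, rfl, rfl⟩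
  · simp
  · rw [map_smul, component_root_pow, smul_ite, smul_zero]

lemma component_root_pow_mul (i : ℤ) (a : ℕ) (r : TruncPoly k n) :
    component k n i (root k n ^ a * r) = root k n ^ a * component k n (i - a) r := by
  rw [← (powBasis k n).sum_repr r]
  simp only [Finset.mul_sum, map_sum]
  refine Finset.sum_congr rfl fun j _ => ?_
  rw [mul_smul_comm, map_smul, map_smul, mul_smul_comm, powBasis_apply, ← pow_add,
    component_root_pow, component_root_pow, mul_ite, mul_zero, ← pow_add]
  congr 1
  refine if_congr ?_ rfl rfl
  push_cast
  omega

lemma iSup_stdGrading : ⨆ i, stdGrading k n i = ⊤ := by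
  rw [eq_top_iff]
  intro r _
  rw [← (powBasis k n).sum_repr r]
  refine Submodule.sum_mem _ fun j _ => Submodule.smul_mem _ _ ?_
  rw [powBasis_apply]
  exact Submodule.mem_iSup_of_mem _ (root_pow_mem _)

lemma irrelevantIdeal_le : irrelevantIdeal (stdGrading k n) ≤ Ideal.span {root k n} := by
  refine Ideal.span_le.2 ?_
  rintro r ⟨i, hi, hr⟩
  rcases exists_of_mem_stdGrading hr with rfl | ⟨a, c, rfl, rfl⟩
  · exact zero_mem _
  · refine Submodule.smul_of_tower_mem _ c ?_
    rw [Ideal.mem_span_singleton]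
    exact dvd_pow_self _ (by omega)

lemma root_pow_mem_irrelevantIdeal {a : ℕ} (ha : 0 < a) (r : TruncPoly k n) :
    root k n ^ a * r ∈ irrelevantIdeal (stdGrading k n) :=
  Ideal.mul_mem_right _ _ (Ideal.subset_span ⟨a, by exact_mod_cast ha, root_pow_mem a⟩)

/-- Any quotient of `r` by x may be replaced by its component of degree i, because projection to
components commutes with multiplication by x up to a shift. -/
lemma exists_eq_root_mul {i : ℤ} {r : TruncPoly k n}
    (hr : r ∈ stdGrading k n (i + 1)) (h : r ∈ Ideal.span {root k n}) :
    ∃ s ∈ stdGrading k n i, root k n * s = r := by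
  obtain ⟨s, rfl⟩ := Ideal.mem_span_singleton.1 h
  refine ⟨component k n i s, component_mem i s, ?_⟩
  have h1 := component_root_pow_mul (i + 1) 1 s
  rw [pow_one, component_of_mem hr, if_pos rfl] at h1
  simpa using h1.symm

/-! ### Graded free modules -/

variable (k n) in
/-- Multiplication by `x`, as a `k`-linear map. -/
noncomputable def mulRoot (m : ℕ) : (Fin m → TruncPoly k n) →ₗ[k] (Fin m → TruncPoly k n) :=
  (LinearMap.lsmul (TruncPoly k n) (Fin m → TruncPoly k n) (root k n)).restrictScalars k

variable (k n) in
/-- The homogeneous components of a graded free module, as `k`-subspaces. -/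
noncomputable def freeComponent {m : ℕ} (a : Fin m → ℤ) (e : ℤ) :
    Submodule k (Fin m → TruncPoly k n) :=
  Submodule.pi Set.univ fun b => stdGrading k n (e - a b)

lemma mulRoot_apply {m : ℕ} (v : Fin m → TruncPoly k n) (b : Fin m) :
    mulRoot k n m v b = root k n * v b := rfl

lemma mem_freeComponent {m : ℕ} {a : Fin m → ℤ} {e : ℤ} {v : Fin m → TruncPoly k n} :
    v ∈ freeComponent k n a e ↔ ∀ b, v b ∈ stdGrading k n (e - a b) := by
  simp [freeComponent, Submodule.mem_pi]

instance finiteDimensional_truncPoly : FiniteDimensional k (TruncPoly k n) :=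
  (powBasis k n).finiteDimensional_of_finite

lemma finrank_submodule_pi {m : ℕ} {W : Type*} [AddCommGroup W] [Module k W]
    [FiniteDimensional k W] (S : Fin m → Submodule k W) :
    Module.finrank k (Submodule.pi Set.univ S) = ∑ b, Module.finrank k (S b) := by
  rw [← Module.finrank_pi_fintype k]
  exact LinearEquiv.finrank_eq
    { toFun := fun v b => ⟨v.1 b, v.2 b trivial⟩
      invFun := fun v => ⟨fun b => v b, fun b _ => (v b).2⟩
      map_add' := fun _ _ => rfl
      map_smul' := fun _ _ => rfl
      left_inv := fun _ => rfl
      right_inv := fun _ => rfl }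

lemma finrank_freeComponent {m : ℕ} (a : Fin m → ℤ) (e : ℤ) :
    Module.finrank k (freeComponent k n a e) = ∑ b, if 0 ≤ e - a b ∧ e - a b < n then 1 else 0 := by
  rw [freeComponent, finrank_submodule_pi]
  simp only [finrank_stdGrading]

/-- The kernel of x on R is spanned by x^{n-1}, so a summand R(-a b) contributes exactly in degree a
b + n - 1. -/
lemma finrank_freeComponent_inf_ker (hn : n ≠ 0) {m : ℕ} (a : Fin m → ℤ) (e : ℤ) :
    Module.finrank k ↥(freeComponent k n a e ⊓ LinearMap.ker (mulRoot k n m)) =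
      ∑ b, if a b = e + 1 - n then 1 else 0 := by
  have h : freeComponent k n a e ⊓ LinearMap.ker (mulRoot k n m) =
      Submodule.pi Set.univ fun b =>
        if a b = e + 1 - n then stdGrading k n (e - a b) else ⊥ := by
    ext v
    simp only [Submodule.mem_inf, mem_freeComponent, LinearMap.mem_ker, Submodule.mem_pi,
      Set.mem_univ, true_imp_iff]
    rw [funext_iff, ← forall_and]
    refine forall_congr' fun b => ?_
    rw [mulRoot_apply, Pi.zero_apply]
    constructor
    · rintro ⟨h1, h2⟩
      split_ifs with h
      · exact h1
      · rw [Submodule.mem_bot]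
        rcases exists_of_mem_stdGrading h1 with h0 | ⟨t, c, ht, h0⟩
        · exact h0
        rw [h0, mul_smul_comm, ← pow_succ'] at h2
        rcases smul_eq_zero.1 h2 with h3 | h3
        · rw [h0, h3, zero_smul]
        · rw [root_pow_eq_zero_iff] at h3
          rw [h0, root_pow_eq_zero_iff.2 (by omega), smul_zero]
    · split_ifs with h
      · intro h1
        refine ⟨h1, ?_⟩
        rcases exists_of_mem_stdGrading h1 with h0 | ⟨t, c, ht, h0⟩
        · rw [h0, mul_zero]
        · rw [h0, mul_smul_comm, ← pow_succ', root_pow_eq_zero_iff.2 (by omega), smul_zero]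
      · intro h1
        rw [Submodule.mem_bot] at h1
        simp [h1]
  rw [h, finrank_submodule_pi]
  refine Finset.sum_congr rfl fun b _ => ?_
  by_cases hb : a b = e + 1 - n
  · rw [if_pos hb, if_pos hb, finrank_stdGrading, if_pos (by omega)]
  · rw [if_neg hb, if_neg hb, finrank_bot]

variable (k n) in
/-- The projection of a graded free module onto its homogeneous component of degree `e`. -/
noncomputable def freeProj {m : ℕ} (a : Fin m → ℤ) (e : ℤ) :
    (Fin m → TruncPoly k n) →ₗ[k] (Fin m → TruncPoly k n) :=
  LinearMap.pi fun b => component k n (e - a b) ∘ₗ LinearMap.proj b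

lemma freeProj_mem {m : ℕ} (a : Fin m → ℤ) (e : ℤ) (v : Fin m → TruncPoly k n) :
    freeProj k n a e v ∈ freeComponent k n a e :=
  mem_freeComponent.2 fun b => component_mem _ (v b)

lemma freeProj_of_mem {m : ℕ} {a : Fin m → ℤ} {e e' : ℤ} {v : Fin m → TruncPoly k n}
    (hv : v ∈ freeComponent k n a e') : freeProj k n a e v = if e' = e then v else 0 := by
  funext b
  have := component_of_mem (i := e - a b) (mem_freeComponent.1 hv b)
  simp only [sub_left_inj] at this
  change component k n (e - a b) (v b) = _
  rw [this]
  split_ifs <;> rfl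

lemma iSup_freeComponent {m : ℕ} (a : Fin m → ℤ) : ⨆ e, freeComponent k n a e = ⊤ := by
  rw [eq_top_iff, ← LinearMap.iSup_range_single (R := k), iSup_le_iff]
  intro b
  rw [← Submodule.map_top, ← iSup_stdGrading, Submodule.map_iSup, iSup_le_iff]
  intro i
  refine le_trans ?_ (le_iSup _ (i + a b))
  rintro _ ⟨r, hr, rfl⟩
  refine mem_freeComponent.2 fun b' => ?_
  by_cases h : b' = b
  · subst h
    simpa using hr
  · simp [h]

end Ring

/-! ### Betti diagrams lie in the cone cut out by the functionals -/

lemma finrank_map_add_finrank_inf_ker {K V W : Type*} [Field K] [AddCommGroup V] [Module K V]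
    [FiniteDimensional K V] [AddCommGroup W] [Module K W] (f : V →ₗ[K] W) (S : Submodule K V) :
    Module.finrank K (S.map f) + Module.finrank K ↥(S ⊓ LinearMap.ker f) = Module.finrank K S := by
  have h := LinearMap.finrank_range_add_finrank_ker (f.domRestrict S)
  rw [LinearMap.range_domRestrict, LinearMap.ker_domRestrict] at h
  rw [← h, ← Submodule.map_comap_subtype,
    Submodule.finrank_map_subtype_eq]

namespace MinimalResolution

variable {k : Type u} [Field k] {n : ℕ} {M : Type u} [AddCommGroup M] [Module (TruncPoly k n) M]
  {ℳ : ℤ → AddSubgroup M} (F : MinimalResolution (stdGrading k n) ℳ)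

/-- The component of degree `e` of `Fᵢ`. -/
noncomputable def freeAt (i : ℕ) (e : ℤ) : Submodule k (Fin (F.rank i) → TruncPoly k n) :=
  freeComponent k n (F.deg i) e

/-- The differential as a `k`-linear map. -/
noncomputable def diff (i : ℕ) :
    (Fin (F.rank (i + 1)) → TruncPoly k n) →ₗ[k] (Fin (F.rank i) → TruncPoly k n) :=
  (F.d i).restrictScalars k

/-- The component of degree `e` of the image of `Fᵢ₊₁ → Fᵢ`. -/
noncomputable def syzygy (i : ℕ) (e : ℤ) : Submodule k (Fin (F.rank i) → TruncPoly k n) :=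
  (F.freeAt (i + 1) e).map (F.diff i)

lemma diff_mem {i : ℕ} {e : ℤ} {v : Fin (F.rank (i + 1)) → TruncPoly k n}
    (hv : v ∈ F.freeAt (i + 1) e) : F.diff i v ∈ F.freeAt i e :=
  mem_freeComponent.2 (F.d_homogeneous i e v (mem_freeComponent.1 hv))

lemma syzygy_le_freeAt (i : ℕ) (e : ℤ) : F.syzygy i e ≤ F.freeAt i e := by
  rintro _ ⟨v, hv, rfl⟩
  exact F.diff_mem hv

lemma diff_freeProj (i : ℕ) (e : ℤ) (v : Fin (F.rank (i + 1)) → TruncPoly k n) :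
    F.diff i (freeProj k n (F.deg (i + 1)) e v) = freeProj k n (F.deg i) e (F.diff i v) := by
  have hv : v ∈ ⨆ e, freeComponent k n (F.deg (i + 1)) e := by
    rw [iSup_freeComponent]
    trivial
  induction hv using Submodule.iSup_induction' with
  | mem e' v hv =>
    rw [freeProj_of_mem hv, freeProj_of_mem (F.diff_mem hv)]
    split_ifs <;> simp
  | zero => simp
  | add v w _ _ hv hw => simp only [map_add, hv, hw]

/-- This is exactness degree by degree: a preimage may be inhomogeneous, but by `diff_freeProj` its
component of degree e is again a preimage. -/
lemma freeAt_inf_ker_diff (i : ℕ) (e : ℤ) :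
    F.freeAt (i + 1) e ⊓ LinearMap.ker (F.diff i) = F.syzygy (i + 1) e := by
  refine le_antisymm ?_ (le_inf (F.syzygy_le_freeAt _ _) ?_)
  · rintro w ⟨hw, hw0⟩
    obtain ⟨u, hu⟩ := (F.exact_succ i w).1 hw0
    refine ⟨freeProj k n _ e u, freeProj_mem _ e u, ?_⟩
    rw [diff_freeProj]
    change freeProj k n _ e (F.d (i + 1) u) = w
    rw [hu, freeProj_of_mem hw, if_pos rfl]
  · rintro _ ⟨v, -, rfl⟩
    exact (F.exact_succ i _).2 ⟨v, rfl⟩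

lemma finrank_syzygy_add (i : ℕ) (e : ℤ) :
    Module.finrank k (F.syzygy i e) + Module.finrank k (F.syzygy (i + 1) e) =
      Module.finrank k (F.freeAt (i + 1) e) := by
  rw [← F.freeAt_inf_ker_diff]
  exact finrank_map_add_finrank_inf_ker _ _

lemma diff_mulRoot (i : ℕ) (v : Fin (F.rank (i + 1)) → TruncPoly k n) :
    F.diff i (mulRoot k n _ v) = mulRoot k n _ (F.diff i v) :=
  (F.d i).map_smul (root k n) v

lemma diff_apply_mem_span (i : ℕ) (v : Fin (F.rank (i + 1)) → TruncPoly k n) (b : Fin (F.rank i)) :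
    F.diff i v b ∈ Ideal.span {root k n} :=
  irrelevantIdeal_le (F.minimal i v b)

lemma syzygy_le_map_mulRoot (i : ℕ) (e : ℤ) :
    F.syzygy i (e + 1) ≤ (F.freeAt i e).map (mulRoot k n _) := by
  rintro w hw
  have h1 := mem_freeComponent.1 (F.syzygy_le_freeAt i (e + 1) hw)
  obtain ⟨v, -, rfl⟩ := hw
  have h2 : ∀ b, ∃ s ∈ stdGrading k n (e - F.deg i b), root k n * s = F.diff i v b := fun b =>
    exists_eq_root_mul (by rw [sub_add_eq_add_sub]; exact h1 b) (F.diff_apply_mem_span i v b)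
  choose s hs hs' using h2
  exact ⟨s, mem_freeComponent.2 hs, funext hs'⟩

lemma map_mulRoot_freeAt_le (i : ℕ) (e : ℤ) :
    (F.freeAt i e).map (mulRoot k n _) ≤ F.freeAt i (e + 1) := by
  rintro _ ⟨v, hv, rfl⟩
  refine mem_freeComponent.2 fun b => ?_
  have h := mul_mem_stdGrading (root_pow_mem (k := k) (n := n) 1) (mem_freeComponent.1 hv b)
  rw [pow_one, show ((1 : ℕ) : ℤ) + (e - F.deg i b) = e + 1 - F.deg i b by push_cast; ring] at h
  exact h

/-- The kernel of x on F_{i+1} is x^{n-1}F_{i+1}. By minimality the differential sends it into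
x^{n-1}·xF_i = 0, so by exactness it lies in the next image. -/
lemma freeAt_inf_ker_mulRoot_le (hn : n ≠ 0) (i : ℕ) (e : ℤ) :
    F.freeAt (i + 1) e ⊓ LinearMap.ker (mulRoot k n _) ≤ F.syzygy (i + 1) e := by
  rw [← F.freeAt_inf_ker_diff]
  refine le_inf inf_le_left ?_
  rintro t ⟨-, ht⟩
  have h1 : ∀ b, ∃ s, t b = root k n ^ (n - 1) * s := fun b => by
    refine root_pow_mul_eq_zero (by omega) ?_
    rw [pow_one]
    exact congrFun ht b
  choose s hs using h1
  have h2 : t = root k n ^ (n - 1) • s := funext hs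
  rw [LinearMap.mem_ker, h2]
  funext b
  obtain ⟨r, hr⟩ := Ideal.mem_span_singleton.1 (F.diff_apply_mem_span i s b)
  have h3 : F.diff i (root k n ^ (n - 1) • s) = root k n ^ (n - 1) • F.diff i s :=
    (F.d i).map_smul _ s
  rw [h3, Pi.smul_apply, hr, smul_eq_mul, ← mul_assoc, ← pow_succ,
    root_pow_eq_zero_iff.2 (by omega), zero_mul, Pi.zero_apply]

/-! ### Betti numbers as dimension counts on syzygies -/

lemma betti_apply (i : ℕ) (j : ℤ) : F.betti i j = ∑ b, if F.deg i b = j then 1 else 0 := by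
  simp [betti, Finsupp.finsetSum_apply, Finsupp.single_apply]

lemma finrank_freeAt_inf_ker (hn : n ≠ 0) (i : ℕ) (e : ℤ) :
    (Module.finrank k ↥(F.freeAt i e ⊓ LinearMap.ker (mulRoot k n _)) : ℚ) =
      F.betti i (e + 1 - n) := by
  rw [freeAt, finrank_freeComponent_inf_ker hn, betti_apply]
  push_cast
  rfl

/-- From degree e to e + 1, generators of degree e + 1 appear, and the summands whose top degree is
e, generated in degree e + 1 - n, disappear. -/
lemma finrank_freeAt_succ (i : ℕ) (e : ℤ) :
    (Module.finrank k (F.freeAt i (e + 1)) : ℚ) + F.betti i (e + 1 - n) =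
      Module.finrank k (F.freeAt i e) + F.betti i (e + 1) := by
  rw [freeAt, freeAt, finrank_freeComponent, finrank_freeComponent, betti_apply, betti_apply]
  push_cast
  rw [← Finset.sum_add_distrib, ← Finset.sum_add_distrib]
  refine Finset.sum_congr rfl fun b _ => ?_
  split_ifs <;> first | omega | simp

lemma finrank_map_mulRoot_freeAt (hn : n ≠ 0) (i : ℕ) (e : ℤ) :
    (Module.finrank k ((F.freeAt i e).map (mulRoot k n _)) : ℚ) + F.betti i (e + 1 - n) =
      Module.finrank k (F.freeAt i e) := by
  rw [← F.finrank_freeAt_inf_ker hn]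
  exact_mod_cast finrank_map_add_finrank_inf_ker _ _

/-- The generators of the image of `Fᵢ₊₁ → Fᵢ` are counted by the Betti numbers of `Fᵢ₊₁`. -/
lemma finrank_map_mulRoot_syzygy (hn : n ≠ 0) (i : ℕ) (e : ℤ) :
    (Module.finrank k ((F.syzygy i e).map (mulRoot k n _)) : ℚ) + F.betti (i + 1) (e + 1) =
      Module.finrank k (F.syzygy i (e + 1)) := by
  set W := (F.freeAt (i + 1) e).map (mulRoot k n _) with hW
  have h1 : (F.syzygy i e).map (mulRoot k n _) = W.map (F.diff i) := by
    rw [hW, syzygy, ← Submodule.map_comp, ← Submodule.map_comp]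
    congr 1
    exact LinearMap.ext fun v => (F.diff_mulRoot i v).symm
  -- Minimality puts the whole kernel in degree e + 1 inside xF_{i+1}, so restricting the
  -- differential to W loses none of it.
  have h2 : W ⊓ LinearMap.ker (F.diff i) = F.syzygy (i + 1) (e + 1) := by
    refine le_antisymm ?_ (le_inf (F.syzygy_le_map_mulRoot _ _) ?_)
    · rw [← F.freeAt_inf_ker_diff]
      exact inf_le_inf_right _ (F.map_mulRoot_freeAt_le _ _)
    · rw [← F.freeAt_inf_ker_diff]
      exact inf_le_right
  have h3 := finrank_map_add_finrank_inf_ker (F.diff i) W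
  rw [h2, ← h1] at h3
  have h4 := F.finrank_syzygy_add i (e + 1)
  have h5 := F.finrank_map_mulRoot_freeAt hn (i + 1) e
  have h6 := F.finrank_freeAt_succ (i + 1) e
  rify at h3 h4
  rify at h5 h6
  rify
  linarith

/-- The elements of a higher syzygy module killed by `x` are counted by shifted Betti numbers. -/
lemma finrank_map_mulRoot_syzygy_succ (hn : n ≠ 0) (i : ℕ) (e : ℤ) :
    (Module.finrank k ((F.syzygy (i + 1) e).map (mulRoot k n _)) : ℚ) +
      F.betti (i + 1) (e + 1 - n) = Module.finrank k (F.syzygy (i + 1) e) := by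
  have h1 : F.syzygy (i + 1) e ⊓ LinearMap.ker (mulRoot k n _) =
      F.freeAt (i + 1) e ⊓ LinearMap.ker (mulRoot k n _) :=
    le_antisymm (inf_le_inf_right _ (F.syzygy_le_freeAt _ _))
      (le_inf (F.freeAt_inf_ker_mulRoot_le hn i e) inf_le_right)
  rw [← F.finrank_freeAt_inf_ker hn, ← h1]
  exact_mod_cast finrank_map_add_finrank_inf_ker _ _

/-- Z_0 need not contain the socle of F_0, so the count for higher syzygies survives only as an
inequality; this is why α_{0,k} is only nonnegative. -/
lemma finrank_syzygy_zero_le (hn : n ≠ 0) (e : ℤ) :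
    (Module.finrank k (F.syzygy 0 e) : ℚ) ≤
      Module.finrank k ((F.syzygy 0 e).map (mulRoot k n _)) + F.betti 0 (e + 1 - n) := by
  rw [← F.finrank_freeAt_inf_ker hn]
  have h := Submodule.finrank_mono (inf_le_inf_right (LinearMap.ker (mulRoot k n _))
    (F.syzygy_le_freeAt 0 e))
  have h' := finrank_map_add_finrank_inf_ker (mulRoot k n _) (F.syzygy 0 e)
  exact_mod_cast (by omega)

/-- Consecutive Betti numbers in terms of the Hilbert function of the syzygy module. -/
lemma betti_add_two (hn : n ≠ 0) (i : ℕ) (e : ℤ) :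
    F.betti (i + 2) (e + 1) + Module.finrank k (F.syzygy i (e + 1)) =
      F.betti (i + 1) (e + 1) + Module.finrank k (F.syzygy i e) := by
  have h1 := F.finrank_map_mulRoot_syzygy hn (i + 1) e
  have h2 := F.finrank_map_mulRoot_syzygy_succ hn i e
  have h3 := F.finrank_syzygy_add i e
  have h4 := F.finrank_syzygy_add i (e + 1)
  have h5 := F.finrank_freeAt_succ (i + 1) e
  rify at h3 h4
  rify at h1 h2 h5
  rify
  linarith

lemma betti_add_three (hn : n ≠ 0) (i : ℕ) (e : ℤ) :
    F.betti (i + 3) (e + 1) = F.betti (i + 1) (e + 1 - n) := by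
  have h1 := F.betti_add_two hn (i + 1) e
  have h2 := F.finrank_map_mulRoot_syzygy_succ hn i e
  have h3 := F.finrank_map_mulRoot_syzygy hn (i + 1) e
  linarith

lemma betti_two_le (hn : n ≠ 0) (e : ℤ) : F.betti 2 (e + 1) ≤ F.betti 0 (e + 1 - n) := by
  have h1 := F.betti_add_two hn 0 e
  have h2 := F.finrank_map_mulRoot_syzygy hn 0 e
  have h3 := F.finrank_syzygy_zero_le hn e
  simp only [zero_add] at h1 h2
  linarith

/-! ### Summation over degrees and the functionals θ, η -/

lemma exists_bound (i : ℕ) : ∃ N : ℤ, ∀ b, -N < F.deg i b ∧ F.deg i b < N := by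
  refine ⟨(∑ b, |F.deg i b|) + 1, fun b => ?_⟩
  have h := Finset.single_le_sum (f := fun b => |F.deg i b|) (fun b _ => abs_nonneg _)
    (Finset.mem_univ b)
  have h1 := abs_le.1 (le_refl |F.deg i b|)
  constructor <;> linarith [h1.1, h1.2]

lemma freeAt_finrank_eq_zero {i : ℕ} {e : ℤ}
    (h : ∀ b, e < F.deg i b ∨ F.deg i b + n ≤ e) : Module.finrank k (F.freeAt i e) = 0 := by
  rw [freeAt, finrank_freeComponent]
  refine Finset.sum_eq_zero fun b _ => if_neg ?_
  have := h b
  omega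

lemma exists_finrank_syzygy_zero_eq_zero :
    ∃ N : ℤ, ∀ e, e < -N ∨ N < e → Module.finrank k (F.syzygy 0 e) = 0 := by
  obtain ⟨N, hN⟩ := F.exists_bound 0
  refine ⟨N + n, fun e he => ?_⟩
  have h0 : Module.finrank k (F.freeAt 0 e) = 0 := F.freeAt_finrank_eq_zero fun b => by
    have := hN b
    omega
  have := Submodule.finrank_mono (F.syzygy_le_freeAt 0 e)
  omega

lemma exists_betti_eq_zero (i : ℕ) :
    ∃ N : ℤ, ∀ e, e < -N ∨ N < e → F.betti i e = 0 := by
  obtain ⟨N, hN⟩ := F.exists_bound i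
  refine ⟨N, fun e he => ?_⟩
  rw [betti_apply]
  refine Finset.sum_eq_zero fun b _ => if_neg ?_
  have := hN b
  omega

/-- `betti_add_two` telescopes, starting from degrees so low that all three terms vanish. -/
lemma cumSum_betti_two (hn : n ≠ 0) (l : ℤ) :
    cumSum l (F.betti 2) + Module.finrank k (F.syzygy 0 l) = cumSum l (F.betti 1) := by
  obtain ⟨N, hN⟩ := F.exists_finrank_syzygy_zero_eq_zero
  obtain ⟨N1, hN1⟩ := F.exists_betti_eq_zero 1
  obtain ⟨N2, hN2⟩ := F.exists_betti_eq_zero 2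
  have hlow : ∀ l, l < -(|N| + |N1| + |N2|) →
      cumSum l (F.betti 2) + Module.finrank k (F.syzygy 0 l) = cumSum l (F.betti 1) := by
    intro l hl
    have a0 := le_abs_self N
    have a1 := le_abs_self N1
    have a2 := le_abs_self N2
    have b0 := abs_nonneg N
    have b1 := abs_nonneg N1
    have b2 := abs_nonneg N2
    rw [hN l (Or.inl (by omega)), cumSum_eq_zero fun j hj => hN1 j (Or.inl (by omega)),
      cumSum_eq_zero fun j hj => hN2 j (Or.inl (by omega))]
    simp
  rcases lt_or_ge l (-(|N| + |N1| + |N2|)) with hl | hl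
  · exact hlow l hl
  · have hl' : -(|N| + |N1| + |N2|) - 1 ≤ l := by omega
    induction l, hl' using Int.leInduction with
    | base => exact hlow _ (by omega)
    | succ l hl' ih =>
      have h1 := cumSum_sub_cumSum_sub_one (l + 1) (F.betti 1)
      have h2 := cumSum_sub_cumSum_sub_one (l + 1) (F.betti 2)
      have h3 := F.betti_add_two hn 0 l
      rw [add_sub_cancel_right] at h1 h2
      simp only [zero_add] at h3
      have ih' : cumSum l (F.betti 2) + Module.finrank k (F.syzygy 0 l) =
          cumSum l (F.betti 1) := by
        rcases lt_or_ge l (-(|N| + |N1| + |N2|)) with h | h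
        · exact hlow l h
        · exact ih h
      linarith

/-- R(-a) is one-dimensional exactly in degrees a, …, a + n - 1, so the generators alive in degree l
are those of degree in (l - n, l]. -/
lemma cumSum_sub_cumSum_betti (i : ℕ) (l : ℤ) :
    cumSum l (F.betti i) - cumSum (l - n) (F.betti i) = Module.finrank k (F.freeAt i l) := by
  have h : F.betti i = ∑ b, Finsupp.single (F.deg i b) 1 := rfl
  rw [h, map_sum, map_sum, freeAt, finrank_freeComponent, ← Finset.sum_sub_distrib]
  push_cast
  refine Finset.sum_congr rfl fun b _ => ?_
  rw [cumSum_single, cumSum_single]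
  split_ifs <;> first | omega | simp

theorem betti_mem_facetCone (hn : n ≠ 0) : F.betti ∈ facetCone n := by
  rw [mem_facetCone_iff]
  refine ⟨fun i _ j => ?_, fun l => ?_, fun l => ?_, fun l => ?_, fun i hi l => ?_, ?_⟩
  · rw [betti_apply]
    exact Finset.sum_nonneg fun b _ => by split_ifs <;> simp
  · have h := F.betti_two_le hn (l + n - 1)
    simpa using h
  · have h1 := F.cumSum_betti_two hn l
    have h2 := F.cumSum_sub_cumSum_betti 1 l
    have h3 := F.finrank_syzygy_add 0 l
    have h4 := F.finrank_map_mulRoot_syzygy_succ hn 0 l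
    have h5 := cumSum_sub_cumSum_sub_one (l - n + 1) (F.betti 1)
    rw [add_sub_cancel_right] at h5
    rw [show l + 1 - n = l - n + 1 by ring] at h4
    simp only [zero_add] at h3 h4
    -- The preceding identities combine to show that θ_l equals this dimension.
    have h6 : (0 : ℚ) ≤ Module.finrank k ((F.syzygy 1 l).map (mulRoot k n _)) := Nat.cast_nonneg _
    have h3' : (Module.finrank k (F.syzygy 0 l) : ℚ) + Module.finrank k (F.syzygy 1 l) =
      Module.finrank k (F.freeAt 1 l) := by exact_mod_cast h3
    linarith
  · have h1 := F.cumSum_betti_two hn (l + 1)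
    have h2 := cumSum_sub_cumSum_sub_one (l + 1) (F.betti 1)
    have h3 := F.finrank_map_mulRoot_syzygy hn 0 l
    rw [add_sub_cancel_right] at h2
    simp only [zero_add] at h3
    -- Likewise η_l equals this dimension.
    have h6 : (0 : ℚ) ≤ Module.finrank k ((F.syzygy 0 l).map (mulRoot k n _)) := Nat.cast_nonneg _
    linarith
  · obtain ⟨i, rfl⟩ := Nat.exists_eq_add_of_le' hi
    have h := F.betti_add_three hn i (l + n - 1)
    simpa [add_assoc] using h.symm
  · obtain ⟨N, hN⟩ := F.exists_finrank_syzygy_zero_eq_zero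
    obtain ⟨N1, hN1⟩ := F.exists_betti_eq_zero 1
    obtain ⟨N2, hN2⟩ := F.exists_betti_eq_zero 2
    have h := F.cumSum_betti_two hn (|N| + |N1| + |N2| + 1)
    have a0 := le_abs_self N
    have a1 := le_abs_self N1
    have a2 := le_abs_self N2
    have b0 := abs_nonneg N
    have b1 := abs_nonneg N1
    have b2 := abs_nonneg N2
    rw [hN _ (Or.inr (by omega)), cumSum_eq_totalSum fun j hj => hN1 j (Or.inr (by omega)),
      cumSum_eq_totalSum fun j hj => hN2 j (Or.inr (by omega))] at h
    simpa using h.symm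

end MinimalResolution

lemma bettiCone_le_pureCone (k : Type u) [Field k] {n : ℕ} (hn : n ≠ 0) :
    bettiCone k n ≤ pureCone n := by
  refine Submodule.span_le.2 ?_
  rintro _ ⟨M, _, _, ℳ, -, -, -, F, rfl⟩
  rw [pureCone_eq_facetCone]
  exact F.betti_mem_facetCone hn

/-! ### Pure diagrams are Betti diagrams of cyclic modules -/

section Cyclic

variable (k : Type u) [Field k] (n : ℕ)

/-- The cyclic module `R/⟨x^c⟩` over `R = k[x]/⟨xⁿ⟩`. -/
abbrev CyclicModule (c : ℕ) : Type u := TruncPoly k n ⧸ Ideal.span {root k n ^ c}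

/-- The homogeneous components of `R/⟨x^c⟩(-p)`, as `k`-subspaces. -/
noncomputable def cyclicSubmodule (c : ℕ) (p j : ℤ) : Submodule k (CyclicModule k n c) :=
  (stdGrading k n (j - p)).map
    (Ideal.Quotient.mkₐ k (Ideal.span {root k n ^ c})).toLinearMap

/-- The grading of `R/⟨x^c⟩(-p)`. -/
noncomputable def cyclicGrading (c : ℕ) (p j : ℤ) : AddSubgroup (CyclicModule k n c) :=
  (cyclicSubmodule k n c p j).toAddSubgroup

variable {k n}

lemma component_mem_span {c : ℕ} {r : TruncPoly k n} (hr : r ∈ Ideal.span {root k n ^ c}) (i : ℤ) :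
    component k n i r ∈ Ideal.span {root k n ^ c} := by
  obtain ⟨s, rfl⟩ := Ideal.mem_span_singleton.1 hr
  rw [component_root_pow_mul]
  exact Ideal.mem_span_singleton.2 (dvd_mul_right _ _)

lemma component_eq_zero_of_mem_iSup {i : ℤ} {r : TruncPoly k n}
    (hr : r ∈ ⨆ (j) (_ : j ≠ i), stdGrading k n j) : component k n i r = 0 := by
  have h : ⨆ (j) (_ : j ≠ i), stdGrading k n j ≤ LinearMap.ker (component k n i) :=
    iSup₂_le fun j hj r hr => by rw [LinearMap.mem_ker, component_of_mem hr, if_neg hj]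
  exact h hr

lemma isInternal_cyclicGrading (c : ℕ) (p : ℤ) :
    DirectSum.IsInternal (cyclicGrading k n c p) := by
  have h : DirectSum.IsInternal (cyclicSubmodule k n c p) := by
    refine DirectSum.isInternal_submodule_of_iSupIndep_of_iSup_eq_top ?_ ?_
    · intro i
      rw [Submodule.disjoint_def]
      rintro _ ⟨r, hr, rfl⟩ h
      simp only [cyclicSubmodule, ← Submodule.map_iSup] at h
      obtain ⟨s, hs, hrs⟩ := h
      have hs' : s ∈ ⨆ (j) (_ : j ≠ i - p), stdGrading k n j :=
        (iSup₂_le fun j hj => le_iSup₂_of_le (j - p) (by omega) le_rfl :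
          ⨆ (j) (_ : j ≠ i), stdGrading k n (j - p) ≤ _) hs
      -- The ideal is homogeneous, so it contains the component of s - r of degree i - p, which is
      -- -r.
      have h1 := component_mem_span (Ideal.Quotient.eq.1 hrs) (i - p)
      rw [map_sub, component_eq_zero_of_mem_iSup hs', component_of_mem hr, if_pos rfl, zero_sub,
        neg_mem_iff] at h1
      exact Ideal.Quotient.eq_zero_iff_mem.2 h1
    · change ⨆ j, cyclicSubmodule k n c p j = ⊤
      simp only [cyclicSubmodule, ← Submodule.map_iSup]
      have h : ⨆ j, stdGrading k n (j - p) = ⨆ j, stdGrading k n j :=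
        (Equiv.subRight p).iSup_comp
      rw [h, iSup_stdGrading, Submodule.map_top,
        LinearMap.range_eq_top]
      exact Ideal.Quotient.mk_surjective
  exact h

lemma gradedSMul_cyclicGrading (c : ℕ) (p : ℤ) :
    SetLike.GradedSMul (stdGrading k n) (cyclicGrading k n c p) where
  smul_mem := by
    rintro i j r _ hr ⟨s, hs, rfl⟩
    refine ⟨r * s, ?_, rfl⟩
    have := mul_mem_stdGrading hr hs
    rwa [← add_sub_assoc] at this

variable (k n) in
/-- The augmentation `R(-p) → R/⟨x^c⟩(-p)`. -/
noncomputable def cyclicAug (c : ℕ) : (Fin 1 → TruncPoly k n) →ₗ[TruncPoly k n] CyclicModule k n c :=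
  (Ideal.span {root k n ^ c}).mkQ ∘ₗ LinearMap.proj 0

lemma cyclicAug_apply (c : ℕ) (v : Fin 1 → TruncPoly k n) :
    cyclicAug k n c v = Ideal.Quotient.mk _ (v 0) := rfl

lemma cyclicAug_mem {c : ℕ} {p e : ℤ} {v : Fin 1 → TruncPoly k n}
    (hv : v ∈ freePart (stdGrading k n) (fun _ => p) e) :
    cyclicAug k n c v ∈ cyclicGrading k n c p e :=
  ⟨v 0, hv 0, rfl⟩

lemma cyclicAug_surjective (c : ℕ) : Function.Surjective (cyclicAug k n c) := fun m => by
  obtain ⟨r, rfl⟩ := Ideal.Quotient.mk_surjective m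
  exact ⟨fun _ => r, rfl⟩

variable (k n) in
/-- Multiplication by `x^c` on `R`, viewed as the free module of rank `1`. -/
noncomputable def mulPow (c : ℕ) :
    (Fin 1 → TruncPoly k n) →ₗ[TruncPoly k n] (Fin 1 → TruncPoly k n) :=
  LinearMap.lsmul (TruncPoly k n) (Fin 1 → TruncPoly k n) (root k n ^ c)

lemma mulPow_apply (c : ℕ) (v : Fin 1 → TruncPoly k n) (b : Fin 1) :
    mulPow k n c v b = root k n ^ c * v b := rfl

variable (k n) in
/-- The minimal resolution of the free module `R(-p)`, presented as `R/⟨xⁿ⟩(-p)`. -/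
noncomputable def freeResolution (p : ℤ) :
    MinimalResolution (stdGrading k n) (cyclicGrading k n n p) where
  rank
    | 0 => 1
    | _ + 1 => 0
  -- Only i = 0 matters here; the index type is empty for i > 0.
  deg _ _ := p
  aug := cyclicAug k n n
  d _ := 0
  aug_homogeneous _ _ hv := cyclicAug_mem hv
  d_homogeneous _ _ _ _ b := by simp
  aug_surjective := cyclicAug_surjective n
  exact_zero v := by
    have h : cyclicAug k n n v = 0 ↔ v 0 = 0 := by
      rw [cyclicAug_apply, Ideal.Quotient.eq_zero_iff_mem, root_pow_eq_zero_iff.2 le_rfl]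
      simp
    rw [h]
    constructor
    · intro hv
      exact ⟨0, funext fun b => by rw [Subsingleton.elim b 0]; exact hv.symm⟩
    · rintro ⟨_, rfl⟩
      rfl
  exact_succ _ v := ⟨fun _ => ⟨0, funext fun b => b.elim0⟩, fun _ => rfl⟩
  minimal _ _ _ := by simp

/-- The annihilator of x^{c'} in R is generated by x^{n-c'} = x^c. -/
lemma mulPow_exact {c c' : ℕ} (h : c + c' = n) :
    Function.Exact (mulPow k n c) (mulPow k n c') := by
  intro v
  constructor
  · intro hv
    obtain ⟨s, hs⟩ := root_pow_mul_eq_zero (by omega) (congrFun hv 0)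
    refine ⟨fun _ => s, funext fun b => ?_⟩
    rw [Subsingleton.elim b 0, hs, mulPow_apply, show n - c' = c by omega]
  · rintro ⟨u, rfl⟩
    funext b
    rw [mulPow_apply, mulPow_apply, ← mul_assoc, ← pow_add, root_pow_eq_zero_iff.2 (by omega),
      zero_mul]
    rfl

variable (k) in
/-- The minimal resolution of `R/⟨x^{d₁-d₀}⟩(-d₀)`. -/
noncomputable def cyclicResolution {e : ℕ → ℤ} (he : StrictMono e)
    (hstep : ∀ i, e (i + 2) - e i = n) :
    MinimalResolution (stdGrading k n) (cyclicGrading k n (e 1 - e 0).toNat (e 0)) where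
  rank _ := 1
  deg i _ := e i
  aug := cyclicAug k n _
  d i := mulPow k n (e (i + 1) - e i).toNat
  aug_homogeneous _ _ hv := cyclicAug_mem hv
  d_homogeneous i j v hv b := by
    have h1 := he (Nat.lt_add_one i)
    have h := mul_mem_stdGrading (root_pow_mem (k := k) (n := n) (e (i + 1) - e i).toNat) (hv b)
    rw [show ((e (i + 1) - e i).toNat : ℤ) + (j - e (i + 1)) = j - e i by omega] at h
    exact h
  aug_surjective := cyclicAug_surjective _
  exact_zero v := by
    rw [cyclicAug_apply, Ideal.Quotient.eq_zero_iff_mem, Ideal.mem_span_singleton]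
    constructor
    · rintro ⟨s, hs⟩
      refine ⟨fun _ => s, funext fun b => ?_⟩
      rw [Subsingleton.elim b 0, hs, mulPow_apply]
    · rintro ⟨u, rfl⟩
      exact ⟨u 0, rfl⟩
  exact_succ i := by
    -- Consecutive exponents sum to e (i + 2) - e i = n.
    refine mulPow_exact ?_
    have h1 := he (Nat.lt_add_one i)
    have h2 := he (Nat.lt_add_one (i + 1))
    have h3 := hstep i
    rw [show i + 1 + 1 = i + 2 by ring] at *
    omega
  minimal i v b := by
    have h1 := he (Nat.lt_add_one i)
    exact root_pow_mem_irrelevantIdeal (by omega) _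

end Cyclic

lemma pureDiagram_mem_bettiDiagrams (k : Type u) [Field k] {n : ℕ} {d : ℕ → WithTop ℤ}
    (hd : IsDegreeSequence n d) : pureDiagram d ∈ bettiDiagrams k n := by
  rcases hd with ⟨h0, htop⟩ | ⟨e, he, hmono, hstep⟩
  · obtain ⟨p, hp⟩ := WithTop.ne_top_iff_exists.1 h0
    refine ⟨_, _, _, cyclicGrading k n n p, inferInstance, isInternal_cyclicGrading n p,
      gradedSMul_cyclicGrading n p, freeResolution k n p, ?_⟩
    funext i
    rcases i with _ | i
    · simp only [pureDiagram, ← hp]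
      change _ = ∑ _ : Fin 1, Finsupp.single p (1 : ℚ)
      rw [Fin.sum_univ_one]
    · simp only [pureDiagram, htop (i + 1) (by omega)]
      change _ = ∑ _ : Fin 0, Finsupp.single p (1 : ℚ)
      rw [Fin.sum_univ_zero]
  · refine ⟨_, _, _, _, inferInstance, isInternal_cyclicGrading _ _,
      gradedSMul_cyclicGrading _ _, cyclicResolution k hmono hstep, ?_⟩
    funext i
    simp only [pureDiagram, he i]
    change _ = ∑ _ : Fin 1, Finsupp.single (e i) (1 : ℚ)
    rw [Fin.sum_univ_one]

lemma pureCone_le_bettiCone (k : Type u) [Field k] (n : ℕ) : pureCone n ≤ bettiCone k n := by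
  refine Submodule.span_mono ?_
  rintro _ ⟨d, hd, rfl⟩
  exact pureDiagram_mem_bettiDiagrams k hd

end BettiCone

theorem theorem3p2 (k : Type u) [Field k] (n : ℕ) (hn : 2 ≤ n) :
    BettiCone.bettiCone k n = BettiCone.pureCone n ∧
    (BettiCone.pureCone n : Set BettiCone.Diagram) = BettiCone.facetCone n :=
  ⟨(BettiCone.bettiCone_le_pureCone k (by omega)).antisymm (BettiCone.pureCone_le_bettiCone k n),
    BettiCone.pureCone_eq_facetCone n⟩
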